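/- Let $M$ workers label $N$ items. Item $j$ has a true label $y_j\in\{\pm1\}$ with $P(y_j=1)=\pi$ for all $j$, and $Z_{ij}$ denotes the label given to item $j$ by worker $i$. Assume the one-coin Dawid–Skene model with full sampling ($q=1$): every worker labels every item, and, conditionally on $(y_1,\dots,y_N)$, the labels $Z_{ij}\in\{\pm1\}$ are independent over all $i,j$, with $P(Z_{ij}=y_j\mid y_1,\dots,y_N)=w_i\in[0,1]$. One-step weighted majority voting is the following rule, where $\operatorname{sign}(0)$ is fixed, by an arbitrary convention, as one of $\pm1$. First compute the majority-vote labels $\hat y_j=\operatorname{sign}\big(\sum_{i=1}^M Z_{ij}\big)$. Then estimate the accuracy of each worker by treating these labels as the truth, $\hat w_i=\frac1N\sum_{j=1}^N \mathbf 1\{Z_{ij}=\hat y_j\}$, and set $v_i=2\hat w_i-1$. Finally predict $\hat y_j^{\,wmv}=\operatorname{sign}\big(\sum_{i=1}^M v_iZ_{ij}\big)$. Let $\bar w=\frac1M\sum_{i=1}^M w_i$. If $$\bar w\ \ge\ \frac12+\frac1M+\sqrt{\frac{(M-1)\ln 2}{2M^2}},$$ then the mean error rate of one-step weighted majority voting satisfies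 $$\frac1N\sum_{j=1}^N P\big(\hat y_j^{\,wmv}\ne y_j\big)\ \le\ \exp\left(-\frac{8MN^2\,\sigma_w^4\,(1-\eta)^2}{M^2N+(M+N)^2}\right),$$ where $$\sigma_w=\sqrt{\frac1M\sum_{i=1}^M\Big(w_i-\frac12\Big)^2},\qquad \eta=2\exp\left(-\frac{2M^2\big(\bar w-\frac12-\frac1M\big)^2}{M-1}\right).$$ -/

import Mathlib

open MeasureTheory

noncomputable section

namespace Crowd

/- Labels live in `SignType = {-1, 0, 1}`: a true or predicted label is `1` or `-1`,
and the entry `0` of a label matrix means that the label is missing. -/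

/-- Probability that a worker of accuracy `w`, who labels the item with probability `q`,
produces the entry `z` when the true label of the item is `y`. -/
def entryProb (q w : ℝ) (y z : SignType) : ℝ :=
  if z = 0 then 1 - q else if z = y then q * w else q * (1 - w)

/-- The one-coin Dawid-Skene model with `M` workers and `N` items, worker accuracies `w`, sampling
probabilities `Q` and prevalence `p` of the label `+1`. Here `Y ω j` is the true label of item `j`
and `Z ω i j` is the label given to it by worker `i`. Conditionally on the true labels, all the
entries of `Z` are independent; nothing is required of the joint law of the true labels beyond
the prevalence. -/
structure IsOneCoinModel {Ω : Type*} [MeasurableSpace Ω] (P : Measure Ω) {M N : ℕ}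
    (w : Fin M → ℝ) (Q : Fin M → Fin N → ℝ) (p : ℝ)
    (Y : Ω → Fin N → SignType) (Z : Ω → Fin M → Fin N → SignType) : Prop where
  accuracy_mem : ∀ i, w i ∈ Set.Icc (0 : ℝ) 1
  sampling_mem : ∀ i j, Q i j ∈ Set.Icc (0 : ℝ) 1
  measurable_labels : ∀ y z, MeasurableSet {ω | Y ω = y ∧ Z ω = z}
  true_ne_zero : ∀ᵐ ω ∂P, ∀ j, Y ω j ≠ 0
  prevalence : ∀ j, P.real {ω | Y ω j = 1} = p
  law : ∀ y z, P.real {ω | Y ω = y ∧ Z ω = z} =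
    P.real {ω | Y ω = y} * ∏ i, ∏ j, entryProb (Q i j) (w i) (y j) (z i j)

/-- The sign of a real number, with the label `τ` at `0`. -/
def signLabel (τ : SignType) (x : ℝ) : SignType :=
  if x = 0 then τ else SignType.sign x

/-- Weighted majority voting with worker weights `v`: the predicted label of each item. -/
def weightedVote {M N : ℕ} (τ : SignType) (v : Fin M → ℝ) (z : Fin M → Fin N → SignType) :
    Fin N → SignType :=
  fun j => signLabel τ (∑ i, v i * (z i j : ℝ))

/-- Majority voting: all the weights are `1`. -/
def majorityVote {M N : ℕ} (τ : SignType) (z : Fin M → Fin N → SignType) : Fin N → SignType :=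
  weightedVote τ (fun _ => 1) z

/-- Estimated accuracy of worker `i` when the labels `g` are treated as the true ones: the
proportion, among the items that worker `i` has labelled, of those labelled as in `g`. -/
def estAccuracy {M N : ℕ} (g : Fin N → SignType) (z : Fin M → Fin N → SignType) (i : Fin M) : ℝ :=
  ((Finset.univ.filter fun j => z i j ≠ 0 ∧ z i j = g j).card : ℝ) /
    ((Finset.univ.filter fun j => z i j ≠ 0).card : ℝ)

/-- One-step weighted majority voting: majority voting, then the accuracies `a i` estimated from
its labels, then weighted majority voting with the weights `2 * a i - 1`. -/
def oneStepWMV {M N : ℕ} (τ : SignType) (z : Fin M → Fin N → SignType) : Fin N → SignType :=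
  weightedVote τ (fun i => 2 * estAccuracy (majorityVote τ z) z i - 1) z

/-- The mean error rate of the predicted labels `Yhat`. -/
def meanErrorRate {Ω : Type*} [MeasurableSpace Ω] (P : Measure Ω) {N : ℕ}
    (Y Yhat : Ω → Fin N → SignType) : ℝ :=
  1 / (N : ℝ) * ∑ j, P.real {ω | Yhat ω j ≠ Y ω j}

/-- The average accuracy of the workers. -/
def avgAccuracy {M : ℕ} (w : Fin M → ℝ) : ℝ := 1 / (M : ℝ) * ∑ i, w i

/-- The dispersion of the accuracies around random guessing. -/
def dispersion {M : ℕ} (w : Fin M → ℝ) : ℝ := √(1 / (M : ℝ) * ∑ i, (w i - 1 / 2) ^ 2)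

/-- The correction term `η`. -/
def eta {M : ℕ} (w : Fin M → ℝ) : ℝ :=
  2 * Real.exp (-(2 * (M : ℝ) ^ 2 * (avgAccuracy w - 1 / 2 - 1 / (M : ℝ)) ^ 2 / ((M : ℝ) - 1)))

end Crowd

end

/-! Fix the true labels `y`. The label matrix is then a family of independent tosses `b (k, i)`,
saying whether worker `i` is right on item `k`. Multiplied by `N` and the true label of `j`, the
weighted vote on `j` becomes `relScore`, the sum over `k` of (is the majority right on `k`?) times
(agreement of the label columns `k` and `j`). An error on `j` forces this score to be nonpositive,
and McDiarmid's inequality bounds that probability. A toss on `j` moves the score by at most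
`2(M+N)`, any other toss by at most `2M`.

The main point is that the mean score is at least `N (1 - η) ∑ (2 w i - 1)^2`. For `k ≠ j`,
independence gives the `k`-th term the mean `∑ (2 w i - 1) E[vote_k * sign_i]`. Removing the toss of
`i` from the event that the vote is wrong leaves two terms. One is a tail probability of the other
`M - 1` tosses, at most `η / 2` by Hoeffding. The other involves the probability `p i` that worker
`i` is pivotal, and has an unfavourable sign when `w i < 1/2`. It is harmless after summation: below
its mean a Poisson-binomial law is increasing (`hitProb_le_succ`), so better workers are more often
pivotal (`monovaryOn_hitProb_erase`), and Chebyshev's sum inequality gives `∑ p i * (2 w i - 1) ≥ 0`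
(`sum_bias_mul_coinMean_le`). -/

open MeasureTheory

noncomputable section

namespace Crowd

/-! ### Finite product expectations of coin tosses and McDiarmid's inequality. -/

section CoinMean

/-- The weight of the outcome `b` of a coin that shows `true` with probability `a`. -/
def coinWeight (a : ℝ) (b : Bool) : ℝ := if b then a else 1 - a

theorem coinWeight_nonneg {a : ℝ} (ha : a ∈ Set.Icc (0 : ℝ) 1) (b : Bool) : 0 ≤ coinWeight a b := by
  have h0 := ha.1
  have h1 := ha.2
  cases b <;> simp [coinWeight] <;> linarith

theorem sum_coinWeight (a : ℝ) : ∑ b, coinWeight a b = 1 := by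
  simp [coinWeight]

variable {ι : Type*} [Fintype ι] [DecidableEq ι]

/-- The expectation of `f` under independent coin tosses with success probabilities `w`. -/
def coinMean (w : ι → ℝ) (f : (ι → Bool) → ℝ) : ℝ := ∑ b, (∏ i, coinWeight (w i) (b i)) * f b

theorem coinMean_mono {w : ι → ℝ} (hw : ∀ i, w i ∈ Set.Icc (0 : ℝ) 1) {f g : (ι → Bool) → ℝ}
    (h : ∀ b, f b ≤ g b) : coinMean w f ≤ coinMean w g :=
  Finset.sum_le_sum fun b _ =>
    mul_le_mul_of_nonneg_left (h b) (Finset.prod_nonneg fun i _ => coinWeight_nonneg (hw i) _)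

theorem coinMean_nonneg {w : ι → ℝ} (hw : ∀ i, w i ∈ Set.Icc (0 : ℝ) 1) {f : (ι → Bool) → ℝ}
    (h : ∀ b, 0 ≤ f b) : 0 ≤ coinMean w f :=
  Finset.sum_nonneg fun b _ =>
    mul_nonneg (Finset.prod_nonneg fun i _ => coinWeight_nonneg (hw i) _) (h b)

theorem coinMean_add (w : ι → ℝ) (f g : (ι → Bool) → ℝ) :
    coinMean w (fun b => f b + g b) = coinMean w f + coinMean w g := by
  simp [coinMean, mul_add, Finset.sum_add_distrib]

theorem coinMean_sub (w : ι → ℝ) (f g : (ι → Bool) → ℝ) :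
    coinMean w (fun b => f b - g b) = coinMean w f - coinMean w g := by
  simp [coinMean, mul_sub, Finset.sum_sub_distrib]

theorem coinMean_const_mul (w : ι → ℝ) (c : ℝ) (f : (ι → Bool) → ℝ) :
    coinMean w (fun b => c * f b) = c * coinMean w f := by
  simp only [coinMean, Finset.mul_sum]
  exact Finset.sum_congr rfl fun b _ => by ring

theorem coinMean_sum (w : ι → ℝ) {κ : Type*} (s : Finset κ) (f : κ → (ι → Bool) → ℝ) :
    coinMean w (fun b => ∑ k ∈ s, f k b) = ∑ k ∈ s, coinMean w (f k) := by
  simp only [coinMean, Finset.mul_sum]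
  exact Finset.sum_comm

theorem coinMean_const (w : ι → ℝ) (c : ℝ) : coinMean w (fun _ => c) = c := by
  have h := Finset.prod_univ_sum (fun _ : ι => (Finset.univ : Finset Bool))
    (fun i b => coinWeight (w i) b)
  simp only [sum_coinWeight, Finset.prod_const_one, Fintype.piFinset_univ] at h
  rw [coinMean, ← Finset.sum_mul, ← h, one_mul]

/-- Conditioning on the toss of the coin `i`. -/
theorem coinMean_split (w : ι → ℝ) (i : ι) (f : (ι → Bool) → ℝ) :
    coinMean w f = w i * coinMean w (fun b => f (Function.update b i true)) +
      (1 - w i) * coinMean w (fun b => f (Function.update b i false)) := by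
  let e := (Equiv.funSplitAt i Bool).symm
  have hprod : ∀ x : Bool × ({j // j ≠ i} → Bool), ∏ l, coinWeight (w l) (e x l) =
      coinWeight (w i) x.1 * ∏ l : {j // j ≠ i}, coinWeight (w l) (x.2 l) := by
    intro x
    rw [Fintype.prod_eq_mul_prod_subtype_ne _ i]
    congr 1
    · simp [e, Equiv.funSplitAt, Equiv.piSplitAt]
    · refine Finset.prod_congr rfl fun l _ => ?_
      have := l.2
      simp [e, Equiv.funSplitAt, Equiv.piSplitAt, this]
  have hupd : ∀ (x : Bool × ({j // j ≠ i} → Bool)) (t : Bool),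
      Function.update (e x) i t = e (t, x.2) := by
    intro x t
    ext l
    by_cases hl : l = i
    · subst hl
      simp [e, Equiv.funSplitAt, Equiv.piSplitAt]
    · simp [e, Equiv.funSplitAt, Equiv.piSplitAt, hl]
  have key : ∀ g : (ι → Bool) → ℝ, coinMean w g = ∑ t, ∑ r : {j // j ≠ i} → Bool,
      coinWeight (w i) t * (∏ l : {j // j ≠ i}, coinWeight (w l) (r l)) * g (e (t, r)) := by
    intro g
    rw [coinMean, ← e.sum_comp, Fintype.sum_prod_type]
    simp only [hprod]
  have hfix : ∀ t : Bool, coinMean w (fun b => f (Function.update b i t)) =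
      ∑ r : {j // j ≠ i} → Bool, (∏ l : {j // j ≠ i}, coinWeight (w l) (r l)) * f (e (t, r)) := by
    intro t
    rw [key]
    simp only [hupd, mul_assoc, ← Finset.mul_sum]
    rw [← Finset.sum_mul, sum_coinWeight, one_mul]
  rw [hfix, hfix, key, Fintype.sum_bool]
  simp only [mul_assoc, ← Finset.mul_sum]
  simp [coinWeight]

/-- Hoeffding's lemma for a coin toss. -/
theorem coin_hoeffding {a : ℝ} (ha : a ∈ Set.Icc (0 : ℝ) 1) {x y c : ℝ} (h : |x - y| ≤ c) (t : ℝ) :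
    a * Real.exp (t * x) + (1 - a) * Real.exp (t * y) ≤
      Real.exp (t * (a * x + (1 - a) * y) + t ^ 2 * c ^ 2 / 8) := by
  obtain ⟨h0, h1⟩ := ha
  -- The two-point law on `x` and `y`, to which Hoeffding's lemma for bounded variables applies.
  let μ : Measure ℝ := ENNReal.ofReal a • Measure.dirac x + ENNReal.ofReal (1 - a) • Measure.dirac y
  have hμ : IsProbabilityMeasure μ := ⟨by
    simp [μ, ← ENNReal.ofReal_add h0 (sub_nonneg.2 h1)]⟩
  have hint : ∀ f : ℝ → ℝ, ∫ z, f z ∂μ = a * f x + (1 - a) * f y := by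
    intro f
    have hi : ∀ (p : ℝ) (z : ℝ), Integrable f (ENNReal.ofReal p • Measure.dirac z) := fun p z =>
      (integrable_dirac (by simp)).smul_measure ENNReal.ofReal_ne_top
    rw [integral_add_measure (hi _ _) (hi _ _)]
    simp [integral_smul_measure, h0, h1]
  have hb : ∀ᵐ z ∂μ, z ∈ Set.Icc (min x y) (max x y) := by
    refine ae_add_measure_iff.2 ⟨Measure.ae_smul_measure ?_ _, Measure.ae_smul_measure ?_ _⟩
    · exact (ae_dirac_iff measurableSet_Icc).2 ⟨min_le_left _ _, le_max_left _ _⟩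
    · exact (ae_dirac_iff measurableSet_Icc).2 ⟨min_le_right _ _, le_max_right _ _⟩
  have hs := (ProbabilityTheory.hasSubgaussianMGF_of_mem_Icc
    (X := id) aemeasurable_id hb).mgf_le t
  simp only [ProbabilityTheory.mgf, hint, id, mul_sub, Real.exp_sub] at hs
  have hc : ‖max x y - min x y‖ ≤ c := by
    rwa [max_sub_min_eq_abs, Real.norm_eq_abs, abs_abs, abs_sub_comm]
  have hc2 : ‖max x y - min x y‖ ^ 2 ≤ c ^ 2 := pow_le_pow_left₀ (norm_nonneg _) hc 2
  have hs' : (a * Real.exp (t * x) + (1 - a) * Real.exp (t * y)) /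
      Real.exp (t * (a * x + (1 - a) * y)) ≤ Real.exp (t ^ 2 * c ^ 2 / 8) := by
    refine le_trans (le_of_eq (by ring_nf)) (hs.trans (Real.exp_le_exp.2 ?_))
    push_cast
    nlinarith [mul_le_mul_of_nonneg_right hc2 (sq_nonneg t)]
  rw [div_le_iff₀ (Real.exp_pos _)] at hs'
  rw [Real.exp_add]
  linarith

/-- Induction on the set of coins that matter. Averaging out one coin keeps the mean and the bounded
differences, and costs one Hoeffding factor; this replaces the martingale argument. -/
theorem coinMean_exp_le_of_dependsOn {w : ι → ℝ} (hw : ∀ i, w i ∈ Set.Icc (0 : ℝ) 1) (c : ι → ℝ)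
    (t : ℝ) (A : Finset ι) : ∀ f : (ι → Bool) → ℝ, DependsOn f (A : Set ι) →
    (∀ i b, |f (Function.update b i true) - f (Function.update b i false)| ≤ c i) →
    coinMean w (fun b => Real.exp (t * f b)) ≤
      Real.exp (t * coinMean w f + t ^ 2 * (∑ i ∈ A, c i ^ 2) / 8) := by
  induction A using Finset.induction_on with
  | empty =>
    intro f hf _
    have hconst : f = fun _ => f (fun _ => true) := by
      funext b
      exact hf (by simp)
    rw [hconst]
    simp [coinMean_const]
  | insert i A hi ih =>
    intro f hf hc
    set g : (ι → Bool) → ℝ := fun b =>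
      w i * f (Function.update b i true) + (1 - w i) * f (Function.update b i false) with hg
    have hgdep : DependsOn g (A : Set ι) := by
      intro b b' hbb'
      have : ∀ s : Bool, f (Function.update b i s) = f (Function.update b' i s) := by
        intro s
        refine hf fun l hl => ?_
        by_cases hli : l = i
        · subst hli; simp
        · have hlA : l ∈ (A : Set ι) := by
            have := Finset.mem_insert.1 (Finset.mem_coe.1 hl)
            exact Finset.mem_coe.2 (this.resolve_left hli)
          simp [hli, hbb' l hlA]
      simp only [hg, this]
    have hgc : ∀ l b, |g (Function.update b l true) - g (Function.update b l false)| ≤ c l := by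
      intro l b
      by_cases hl : l = i
      · subst hl
        simpa [hg] using (abs_nonneg _).trans (hc l b)
      · have h1 := hc l (Function.update b i true)
        have h2 := hc l (Function.update b i false)
        simp only [hg, Function.update_comm hl]
        obtain ⟨hw0, hw1⟩ := hw i
        rw [abs_le] at h1 h2 ⊢
        constructor <;> nlinarith
    have hmean : coinMean w g = coinMean w f := by
      rw [coinMean_split w i f, hg, coinMean_add, coinMean_const_mul, coinMean_const_mul]
    calc coinMean w (fun b => Real.exp (t * f b))
        = coinMean w (fun b => w i * Real.exp (t * f (Function.update b i true)) +
            (1 - w i) * Real.exp (t * f (Function.update b i false))) := by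
          rw [coinMean_split w i, coinMean_add, coinMean_const_mul, coinMean_const_mul]
      _ ≤ coinMean w (fun b => Real.exp (t ^ 2 * c i ^ 2 / 8) * Real.exp (t * g b)) := by
          refine coinMean_mono hw fun b => ?_
          rw [← Real.exp_add, add_comm (t ^ 2 * c i ^ 2 / 8)]
          exact coin_hoeffding (hw i) (hc i b) t
      _ ≤ Real.exp (t ^ 2 * c i ^ 2 / 8) *
            Real.exp (t * coinMean w g + t ^ 2 * (∑ i ∈ A, c i ^ 2) / 8) := by
          rw [coinMean_const_mul]
          exact mul_le_mul_of_nonneg_left (ih g hgdep hgc) (Real.exp_pos _).le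
      _ = _ := by
          rw [← Real.exp_add, hmean, Finset.sum_insert hi]
          ring_nf

/-- McDiarmid's inequality for independent coin tosses. -/
theorem coinMean_le_exp_of_bounded_differences {w : ι → ℝ} (hw : ∀ i, w i ∈ Set.Icc (0 : ℝ) 1)
    (c : ι → ℝ) (f : (ι → Bool) → ℝ)
    (hc : ∀ i b, |f (Function.update b i true) - f (Function.update b i false)| ≤ c i)
    {r C : ℝ} (hr : 0 ≤ r) (hC : ∑ i, c i ^ 2 ≤ C) (hC0 : 0 < C) {x : ℝ}
    (hx : x + r ≤ coinMean w f) :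
    coinMean w (fun b => if f b ≤ x then 1 else 0) ≤ Real.exp (-(2 * r ^ 2 / C)) := by
  -- The minimiser of `t * r + t ^ 2 * C / 8`; it is negative because a lower tail is bounded.
  set t : ℝ := -(4 * r / C) with ht
  have ht0 : t ≤ 0 := by
    have : 0 ≤ 4 * r / C := by positivity
    linarith
  calc coinMean w (fun b => if f b ≤ x then 1 else 0)
      ≤ coinMean w (fun b => Real.exp (-(t * x)) * Real.exp (t * f b)) := by
        refine coinMean_mono hw fun b => ?_
        rw [← Real.exp_add]
        split_ifs with h
        · refine Real.one_le_exp ?_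
          nlinarith
        · exact (Real.exp_pos _).le
    _ ≤ Real.exp (-(t * x)) * Real.exp (t * coinMean w f + t ^ 2 * (∑ i, c i ^ 2) / 8) := by
        rw [coinMean_const_mul]
        exact mul_le_mul_of_nonneg_left (coinMean_exp_le_of_dependsOn hw c t Finset.univ f
          (fun b b' h => congrArg f (funext fun i => h i (by simp))) hc) (Real.exp_pos _).le
    _ ≤ Real.exp (-(2 * r ^ 2 / C)) := by
        rw [← Real.exp_add, Real.exp_le_exp]
        have h1 : t * (coinMean w f - x) ≤ t * r := by nlinarith
        have h2 : t ^ 2 * (∑ i, c i ^ 2) ≤ t ^ 2 * C :=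
          mul_le_mul_of_nonneg_left hC (sq_nonneg t)
        have h3 : t * r + t ^ 2 * C / 8 = -(2 * r ^ 2 / C) := by
          rw [ht]; field_simp; ring
        linarith

end CoinMean

/-! ### Poisson-binomial laws, pivotal probabilities and the sum of correlations. -/

section Hits

variable {ι : Type*} [Fintype ι] [DecidableEq ι]

/-- The number of coins in `S` that show `true`. -/
def hits (S : Finset ι) (b : ι → Bool) : ℕ := ∑ i ∈ S, if b i then 1 else 0

/-- The sign `1` or `-1` of a coin toss. -/
def coinSign (b : Bool) : ℝ := if b then 1 else -1

/-- The probability that exactly `k` of the coins in `S` show `true`. -/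
def hitProb (w : ι → ℝ) (S : Finset ι) (k : ℕ) : ℝ :=
  coinMean w fun b => if hits S b = k then 1 else 0

omit [Fintype ι] in
theorem hits_update_of_notMem {S : Finset ι} {i : ι} (hi : i ∉ S) (b : ι → Bool) (t : Bool) :
    hits S (Function.update b i t) = hits S b := by
  refine Finset.sum_congr rfl fun l hl => ?_
  rw [Function.update_of_ne (ne_of_mem_of_not_mem hl hi)]

omit [Fintype ι] in
theorem hits_update_true {S : Finset ι} {i : ι} (hi : i ∈ S) (b : ι → Bool) :
    hits S (Function.update b i true) = hits (S.erase i) b + 1 := by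
  rw [hits, ← Finset.sum_erase_add _ _ hi, ← hits, hits_update_of_notMem (Finset.notMem_erase i S)]
  simp

omit [Fintype ι] in
theorem hits_update_false {S : Finset ι} {i : ι} (hi : i ∈ S) (b : ι → Bool) :
    hits S (Function.update b i false) = hits (S.erase i) b := by
  rw [hits, ← Finset.sum_erase_add _ _ hi, ← hits, hits_update_of_notMem (Finset.notMem_erase i S)]
  simp

theorem hitProb_nonneg {w : ι → ℝ} (hw : ∀ i, w i ∈ Set.Icc (0 : ℝ) 1) (S : Finset ι) (k : ℕ) :
    0 ≤ hitProb w S k :=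
  coinMean_nonneg hw fun b => by split_ifs <;> norm_num

theorem hitProb_zero (w : ι → ℝ) {S : Finset ι} {i : ι} (hi : i ∈ S) :
    hitProb w S 0 = (1 - w i) * hitProb w (S.erase i) 0 := by
  rw [hitProb, coinMean_split w i]
  simp [hits_update_true hi, hits_update_false hi, coinMean_const, hitProb]

theorem hitProb_succ (w : ι → ℝ) {S : Finset ι} {i : ι} (hi : i ∈ S) (k : ℕ) :
    hitProb w S (k + 1) =
      w i * hitProb w (S.erase i) k + (1 - w i) * hitProb w (S.erase i) (k + 1) := by
  rw [hitProb, coinMean_split w i]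
  simp [hits_update_true hi, hits_update_false hi, hitProb]

/-- Double counting: on the event of `k + 1` hits, `k + 1` is the sum of the indicators of the
single coins. -/
theorem succ_mul_hitProb_succ (w : ι → ℝ) (S : Finset ι) (k : ℕ) :
    ((k : ℝ) + 1) * hitProb w S (k + 1) = ∑ i ∈ S, w i * hitProb w (S.erase i) k := by
  have h : ∀ b : ι → Bool, ((k : ℝ) + 1) * (if hits S b = k + 1 then 1 else 0) =
      ∑ i ∈ S, (if b i then (1 : ℝ) else 0) * (if hits S b = k + 1 then 1 else 0) := by
    intro b
    rw [← Finset.sum_mul]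
    by_cases hb : hits S b = k + 1
    · have : (hits S b : ℝ) = k + 1 := by exact_mod_cast hb
      simp only [hb, if_true, mul_one]
      rw [← this, hits]
      push_cast
      rfl
    · simp [hb]
  rw [hitProb, ← coinMean_const_mul]
  simp only [h]
  rw [coinMean_sum]
  refine Finset.sum_congr rfl fun i hi => ?_
  rw [coinMean_split w i]
  simp [hits_update_true hi, hitProb, coinMean_const]

/-- The law of a sum of independent Bernoulli variables increases up to its mean. -/
theorem hitProb_le_succ {w : ι → ℝ} (hw : ∀ i, w i ∈ Set.Icc (0 : ℝ) 1) (k : ℕ) :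
    ∀ S : Finset ι, (k : ℝ) + 1 ≤ ∑ i ∈ S, w i → hitProb w S k ≤ hitProb w S (k + 1) := by
  induction k with
  | zero =>
    intro S hS
    have h1 := succ_mul_hitProb_succ w S 0
    have h2 : ∑ i ∈ S, w i * hitProb w S 0 ≤ ∑ i ∈ S, w i * hitProb w (S.erase i) 0 := by
      refine Finset.sum_le_sum fun i hi => mul_le_mul_of_nonneg_left ?_ (hw i).1
      rw [hitProb_zero w hi]
      nlinarith [(hw i).1, hitProb_nonneg hw (S.erase i) 0]
    rw [← Finset.sum_mul] at h2
    push_cast at h1 hS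
    nlinarith [hitProb_nonneg hw S 0]
  | succ k ih =>
    intro S hS
    have h1 := succ_mul_hitProb_succ w S (k + 1)
    -- Together with `h1` this gives `(k + 2) P(k + 2) ≥ (∑ w) P(k + 1)`, and the mean is at least
    -- `k + 2`. Erasing a coin lowers the mean by at most one, so the induction hypothesis applies
    -- to `S.erase i`.
    have h2 : ∑ i ∈ S, w i * hitProb w S (k + 1) ≤
        ∑ i ∈ S, w i * hitProb w (S.erase i) (k + 1) := by
      refine Finset.sum_le_sum fun i hi => mul_le_mul_of_nonneg_left ?_ (hw i).1
      have h3 : hitProb w (S.erase i) k ≤ hitProb w (S.erase i) (k + 1) := by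
        refine ih _ ?_
        have := Finset.sum_erase_add S w hi
        push_cast at hS
        linarith [(hw i).2]
      rw [hitProb_succ w hi]
      nlinarith [(hw i).1]
    rw [← Finset.sum_mul] at h2
    have h4 : ((k + 1 : ℕ) : ℝ) + 1 > 0 := by positivity
    refine le_of_mul_le_mul_left ?_ h4
    nlinarith [hitProb_nonneg hw S (k + 1)]

/-- The correlation of one toss with the event that few coins of `S` show `true`. -/
theorem coinMean_hits_lt_mul_coinSign (w : ι → ℝ) {S : Finset ι} {i : ι} (hi : i ∈ S) (k : ℕ) :
    coinMean w (fun b => (if hits S b < k + 1 then 1 else 0) * coinSign (b i)) =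
      (2 * w i - 1) * coinMean w (fun b => if hits (S.erase i) b < k + 1 then 1 else 0) -
        w i * hitProb w (S.erase i) k := by
  -- If coin `i` shows `true`, the others have one hit less to spare; the two events differ by the
  -- pivotal one.
  have h : ∀ b : ι → Bool, (if hits (S.erase i) b < k then (1 : ℝ) else 0) =
      (if hits (S.erase i) b < k + 1 then 1 else 0) -
        (if hits (S.erase i) b = k then 1 else 0) := by
    intro b
    split_ifs <;> first | omega | norm_num
  rw [coinMean_split w i]
  simp only [hits_update_true hi, hits_update_false hi, Function.update_self, coinSign,
    add_lt_add_iff_right, if_true, mul_one, Bool.false_eq_true, if_false, h, coinMean_sub]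
  have h2 := coinMean_const_mul w (-1)
    (fun b => if hits (S.erase i) b < k + 1 then (1 : ℝ) else 0)
  simp only [mul_comm _ (-1 : ℝ), h2, hitProb]
  ring

/-- If the pivotal probability is unimodal, then more accurate coins are more often pivotal. -/
theorem monovaryOn_hitProb_erase {w : ι → ℝ} (hw : ∀ i, w i ∈ Set.Icc (0 : ℝ) 1) {S : Finset ι}
    {k : ℕ} (hk : (k : ℝ) + 3 ≤ ∑ i ∈ S, w i) :
    MonovaryOn (fun i => hitProb w (S.erase i) (k + 1)) w S := by
  intro i hi l hl hil
  have hne : i ≠ l := fun h => by simp [h] at hil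
  have hi' : i ∈ S.erase l := Finset.mem_erase.2 ⟨hne, hi⟩
  have hl' : l ∈ S.erase i := Finset.mem_erase.2 ⟨hne.symm, hl⟩
  have hmean : (k : ℝ) + 1 ≤ ∑ x ∈ (S.erase i).erase l, w x := by
    have h1 := Finset.sum_erase_add S w hi
    have h2 := Finset.sum_erase_add (S.erase i) w hl'
    linarith [(hw i).2, (hw l).2]
  have h := hitProb_le_succ hw k _ hmean
  -- Conditioning each pivotal probability on the other coin makes their difference `(w l - w i)`
  -- times the increment of the law of the coins left.
  simp only [hitProb_succ w hi', hitProb_succ w hl', Finset.erase_right_comm (a := l) (b := i)]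
  nlinarith

/-- A bound for each `i` would fail when `w i < 1/2`, since the pivotal term then has the wrong
sign; only the sum is controlled, by Chebyshev's sum inequality. -/
theorem sum_bias_mul_coinMean_le {w : ι → ℝ} (hw : ∀ i, w i ∈ Set.Icc (0 : ℝ) 1) {S : Finset ι}
    {k : ℕ} (hk : (k : ℝ) + 3 ≤ ∑ i ∈ S, w i) (hS : 0 ≤ ∑ i ∈ S, (2 * w i - 1)) {δ : ℝ}
    (hδ : ∀ i ∈ S, coinMean w (fun b => if hits (S.erase i) b < k + 2 then 1 else 0) ≤ δ) :
    ∑ i ∈ S, (2 * w i - 1) *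
      coinMean w (fun b => (if hits S b < k + 2 then 1 else 0) * coinSign (b i)) ≤
        δ * ∑ i ∈ S, (2 * w i - 1) ^ 2 := by
  set p : ι → ℝ := fun i => hitProb w (S.erase i) (k + 1) with hp
  have hp0 : ∀ i, 0 ≤ p i := fun i => hitProb_nonneg hw _ _
  have hmono : MonovaryOn p (fun i => 2 * w i - 1) S := by
    intro i hi l hl hil
    exact monovaryOn_hitProb_erase hw hk hi hl (by simp only at hil; linarith)
  have hcheb := hmono.sum_mul_sum_le_card_mul_sum
  have hpos : 0 ≤ (S.card : ℝ) * ∑ i ∈ S, p i * (2 * w i - 1) :=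
    le_trans (mul_nonneg (Finset.sum_nonneg fun i _ => hp0 i) hS) hcheb
  have hcorr : 0 ≤ ∑ i ∈ S, p i * (2 * w i - 1) := by
    rcases S.eq_empty_or_nonempty with rfl | hne
    · simp
    · exact nonneg_of_mul_nonneg_right hpos (by exact_mod_cast hne.card_pos)
  -- The factor `1 / 2` comes from `w i = 1 / 2 + (2 * w i - 1) / 2`; the second half contributes a
  -- square with a favourable sign and is dropped.
  have hle : ∑ i ∈ S, (2 * w i - 1) *
      coinMean w (fun b => (if hits S b < k + 2 then 1 else 0) * coinSign (b i)) ≤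
        ∑ i ∈ S, (δ * (2 * w i - 1) ^ 2 - 1 / 2 * (p i * (2 * w i - 1))) := by
    refine Finset.sum_le_sum fun i hi => ?_
    rw [coinMean_hits_lt_mul_coinSign w hi (k + 1)]
    have h1 := mul_le_mul_of_nonneg_right (hδ i hi) (sq_nonneg (2 * w i - 1))
    have h2 := mul_nonneg (hp0 i) (sq_nonneg (2 * w i - 1))
    simp only [hp] at h2 ⊢
    nlinarith
  rw [Finset.sum_sub_distrib, ← Finset.mul_sum, ← Finset.mul_sum] at hle
  linarith

theorem coinMean_hits (w : ι → ℝ) (S : Finset ι) :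
    coinMean w (fun b => (hits S b : ℝ)) = ∑ i ∈ S, w i := by
  have : ∀ b : ι → Bool, (hits S b : ℝ) = ∑ i ∈ S, if b i then (1 : ℝ) else 0 := by
    intro b
    simp [hits]
  simp only [this, coinMean_sum]
  refine Finset.sum_congr rfl fun i _ => ?_
  rw [coinMean_split w i]
  simp [coinMean_const]

/-- Hoeffding's inequality for the number of hits. -/
theorem coinMean_hits_lt_le {w : ι → ℝ} (hw : ∀ i, w i ∈ Set.Icc (0 : ℝ) 1) {S : Finset ι}
    (hS : S.Nonempty) {h : ℕ} {r : ℝ} (hr : 0 ≤ r) (hmean : (h : ℝ) - 1 + r ≤ ∑ i ∈ S, w i) :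
    coinMean w (fun b => if hits S b < h then 1 else 0) ≤
      Real.exp (-(2 * r ^ 2 / S.card)) := by
  have hdiff : ∀ i b, |(hits S (Function.update b i true) : ℝ) -
      hits S (Function.update b i false)| ≤ if i ∈ S then 1 else 0 := by
    intro i b
    split_ifs with hi
    · simp [hits_update_true hi, hits_update_false hi]
    · simp [hits_update_of_notMem hi]
  have hmain := coinMean_le_exp_of_bounded_differences hw (fun i => if i ∈ S then 1 else 0)
    (fun b => (hits S b : ℝ)) hdiff hr (C := S.card) (x := (h : ℝ) - 1)
    (by simp) (by exact_mod_cast hS.card_pos) (by rwa [coinMean_hits])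
  refine le_trans (coinMean_mono hw fun b => ?_) hmain
  by_cases hb : hits S b < h
  · have : (hits S b : ℝ) ≤ h - 1 := by
      have : (hits S b : ℝ) + 1 ≤ h := by exact_mod_cast hb
      linarith
    simp [hb, this]
  · simp only [hb, if_false]
    split_ifs <;> norm_num

end Hits

/-! ### The relative score: bounded differences and a lower bound for its mean. -/

section Score

variable {M N : ℕ}

/-- The tosses that belong to the item `k`. -/
def itemCoins (M : ℕ) {N : ℕ} (k : Fin N) : Finset (Fin N × Fin M) := {k} ×ˢ Finset.univ

theorem mem_itemCoins {k : Fin N} {x : Fin N × Fin M} : x ∈ itemCoins M k ↔ x.1 = k := by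
  simp [itemCoins, Prod.ext_iff, eq_comm]

theorem sum_itemCoins (k : Fin N) (f : Fin N × Fin M → ℝ) :
    ∑ x ∈ itemCoins M k, f x = ∑ i, f (k, i) := by
  simp [itemCoins]

theorem card_itemCoins (k : Fin N) : (itemCoins M k).card = M := by
  simp [itemCoins]

/-- The vote on the item `k`, relative to its true label, when `h` correct labels are needed for
it to be right. -/
def relVote (h : Fin N → ℕ) (k : Fin N) (b : Fin N × Fin M → Bool) : ℝ :=
  if hits (itemCoins M k) b < h k then -1 else 1

/-- The agreement of the labels of the items `k` and `j`, relative to the true labels. -/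
def agreement (j k : Fin N) (b : Fin N × Fin M → Bool) : ℝ :=
  ∑ i, coinSign (b (k, i)) * coinSign (b (j, i))

/-- The weighted vote on the item `j`, relative to its true label and scaled by `N`. -/
def relScore (h : Fin N → ℕ) (j : Fin N) (b : Fin N × Fin M → Bool) : ℝ :=
  ∑ k, relVote h k b * agreement j k b

theorem abs_coinSign (b : Bool) : |coinSign b| = 1 := by
  cases b <;> simp [coinSign]

theorem coinSign_mul_self (b : Bool) : coinSign b * coinSign b = 1 := by
  cases b <;> simp [coinSign]

theorem abs_relVote (h : Fin N → ℕ) (k : Fin N) (b : Fin N × Fin M → Bool) :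
    |relVote h k b| = 1 := by
  unfold relVote
  split_ifs <;> simp

theorem agreement_self (j : Fin N) (b : Fin N × Fin M → Bool) : agreement j j b = M := by
  simp [agreement, coinSign_mul_self]

theorem abs_agreement_le (j k : Fin N) (b : Fin N × Fin M → Bool) : |agreement j k b| ≤ M := by
  refine (Finset.abs_sum_le_sum_abs _ _).trans ?_
  simp [abs_mul, abs_coinSign]

theorem relVote_update_of_ne (h : Fin N → ℕ) {k : Fin N} {x : Fin N × Fin M} (hx : x.1 ≠ k)
    (b : Fin N × Fin M → Bool) (t : Bool) :
    relVote h k (Function.update b x t) = relVote h k b := by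
  rw [relVote, hits_update_of_notMem (by rwa [mem_itemCoins]), relVote]

theorem agreement_update_of_ne {j k : Fin N} {x : Fin N × Fin M} (hk : x.1 ≠ k) (hj : x.1 ≠ j)
    (b : Fin N × Fin M → Bool) (t : Bool) :
    agreement j k (Function.update b x t) = agreement j k b := by
  refine Finset.sum_congr rfl fun i _ => ?_
  rw [Function.update_of_ne, Function.update_of_ne]
  · rintro rfl; exact hj rfl
  · rintro rfl; exact hk rfl

theorem abs_agreement_update_sub_le {j k : Fin N} (hkj : k ≠ j) (l : Fin M)
    (b : Fin N × Fin M → Bool) :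
    |agreement j k (Function.update b (j, l) true) -
      agreement j k (Function.update b (j, l) false)| ≤ 2 := by
  rw [agreement, agreement, ← Finset.sum_sub_distrib]
  refine (Finset.abs_sum_le_sum_abs _ _).trans ?_
  calc _ ≤ ∑ i : Fin M, if i = l then (2 : ℝ) else 0 := by
        refine Finset.sum_le_sum fun i _ => ?_
        have hne : (k, i) ≠ (j, l) := fun h => hkj (congrArg Prod.fst h)
        rw [Function.update_of_ne hne, Function.update_of_ne hne, ← mul_sub, abs_mul,
          abs_coinSign, one_mul]
        by_cases hi : i = l
        · subst hi
          simp [coinSign]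
          norm_num
        · simp [hi]
    _ = 2 := by simp

/-- A toss on `j` can flip the vote on `j`, worth `2 * M`, and shifts each other agreement by at
most 2. A toss on another item affects only the term of that item, whose absolute value is at most
`M`. -/
theorem abs_relScore_update_sub_le (h : Fin N → ℕ) (j : Fin N) (x : Fin N × Fin M)
    (b : Fin N × Fin M → Bool) :
    |relScore h j (Function.update b x true) - relScore h j (Function.update b x false)| ≤
      if x.1 = j then 2 * ((M : ℝ) + N) else 2 * M := by
  have hcrude : ∀ k, |relVote h k (Function.update b x true) *
      agreement j k (Function.update b x true) - relVote h k (Function.update b x false) *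
      agreement j k (Function.update b x false)| ≤ 2 * M := by
    intro k
    refine (abs_sub _ _).trans ?_
    rw [abs_mul, abs_mul, abs_relVote, abs_relVote]
    linarith [abs_agreement_le j k (Function.update b x true),
      abs_agreement_le j k (Function.update b x false)]
  rw [relScore, relScore, ← Finset.sum_sub_distrib]
  refine (Finset.abs_sum_le_sum_abs _ _).trans ?_
  split_ifs with hx
  · calc _ ≤ ∑ k : Fin N, ((if k = j then 2 * (M : ℝ) else 0) + 2) := by
          refine Finset.sum_le_sum fun k _ => ?_
          split_ifs with hk
          · linarith [hcrude k]
          · have hxk : x.1 ≠ k := fun h => hk (h.symm.trans hx)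
            rw [relVote_update_of_ne h hxk, relVote_update_of_ne h hxk, ← mul_sub, abs_mul,
              abs_relVote, one_mul, zero_add]
            obtain ⟨x1, x2⟩ := x
            subst hx
            exact abs_agreement_update_sub_le hk x2 b
      _ = _ := by
          simp [Finset.sum_add_distrib]
          ring
  · calc _ ≤ ∑ k : Fin N, (if k = x.1 then 2 * (M : ℝ) else 0) := by
          refine Finset.sum_le_sum fun k _ => ?_
          split_ifs with hk
          · exact hcrude k
          · have hxk : x.1 ≠ k := fun h => hk h.symm
            rw [relVote_update_of_ne h hxk, relVote_update_of_ne h hxk,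
              agreement_update_of_ne hxk hx, agreement_update_of_ne hxk hx, sub_self, abs_zero]
      _ = _ := by simp

theorem sum_sq_difference_le (j : Fin N) :
    ∑ x : Fin N × Fin M, (if x.1 = j then 2 * ((M : ℝ) + N) else 2 * M) ^ 2 ≤
      4 * M * ((M : ℝ) ^ 2 * N + ((M : ℝ) + N) ^ 2) := by
  -- The tosses on `j` are charged `(2 * M) ^ 2` in addition to their own square, which produces `M
  -- ^ 2 * N`.
  calc _ ≤ ∑ x : Fin N × Fin M,
        ((if x.1 = j then (2 * ((M : ℝ) + N)) ^ 2 else 0) + (2 * (M : ℝ)) ^ 2) := by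
        refine Finset.sum_le_sum fun x _ => ?_
        split_ifs
        · nlinarith
        · simp
    _ = _ := by
        rw [Fintype.sum_prod_type_right]
        simp [Finset.sum_add_distrib]
        ring

theorem coinMean_relVote_mul_coinSign (W : Fin N × Fin M → ℝ) (h : Fin N → ℕ) (k : Fin N)
    (x : Fin N × Fin M) :
    coinMean W (fun b => relVote h k b * coinSign (b x)) = (2 * W x - 1) -
      2 * coinMean W (fun b => (if hits (itemCoins M k) b < h k then 1 else 0) *
        coinSign (b x)) := by
  have h1 : ∀ b : Fin N × Fin M → Bool, relVote h k b * coinSign (b x) = coinSign (b x) -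
      2 * ((if hits (itemCoins M k) b < h k then 1 else 0) * coinSign (b x)) := by
    intro b
    unfold relVote
    split_ifs <;> ring
  have h2 : coinMean W (fun b => coinSign (b x)) = 2 * W x - 1 := by
    rw [coinMean_split W x]
    simp [coinSign, coinMean_const]
    ring
  simp only [h1]
  rw [coinMean_sub, h2, coinMean_const_mul]

/-- The vote on `k` does not involve the tosses on `j`, so each sign on `j` can be averaged
separately to `2 * W (j, i) - 1`. -/
theorem coinMean_relVote_mul_agreement (W : Fin N × Fin M → ℝ) (h : Fin N → ℕ) {j k : Fin N}
    (hkj : k ≠ j) :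
    coinMean W (fun b => relVote h k b * agreement j k b) =
      ∑ i, (2 * W (j, i) - 1) * coinMean W (fun b => relVote h k b * coinSign (b (k, i))) := by
  simp only [agreement, Finset.mul_sum]
  rw [coinMean_sum]
  refine Finset.sum_congr rfl fun i _ => ?_
  have hne : (k, i) ≠ (j, i) := fun h => hkj (congrArg Prod.fst h)
  have hupd : ∀ t, coinMean W (fun b => relVote h k (Function.update b (j, i) t) *
      coinSign (Function.update b (j, i) t (k, i))) =
        coinMean W (fun b => relVote h k b * coinSign (b (k, i))) := by
    intro t
    simp only [relVote_update_of_ne h (x := (j, i)) hkj.symm, Function.update_of_ne hne]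
  have hneg := coinMean_const_mul W (-1) (fun b => relVote h k b * coinSign (b (k, i)))
  rw [coinMean_split W (j, i)]
  simp only [relVote_update_of_ne h (x := (j, i)) hkj.symm, Function.update_of_ne hne,
    Function.update_self, coinSign, if_true, mul_one, Bool.false_eq_true, if_false] at hneg ⊢
  simp only [mul_neg, mul_one, neg_mul, one_mul] at hneg ⊢
  rw [hneg]
  ring

theorem le_coinMean_relScore {w : Fin M → ℝ} (hw : ∀ i, w i ∈ Set.Icc (0 : ℝ) 1)
    (hsum : (M : ℝ) / 2 + 2 ≤ ∑ i, w i) {h : Fin N → ℕ} (hlow : ∀ k, M ≤ 2 * h k)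
    (hupp : ∀ k, 2 * h k ≤ M + 2)
    (hη : 2 * Real.exp (-(2 * (∑ i, w i - M / 2 - 1) ^ 2 / (M - 1))) ≤ 1) (j : Fin N) :
    N * ((1 - 2 * Real.exp (-(2 * (∑ i, w i - M / 2 - 1) ^ 2 / (M - 1)))) *
      ∑ i, (2 * w i - 1) ^ 2) ≤ coinMean (fun x : Fin N × Fin M => w x.2) (relScore h j) := by
  set δ := Real.exp (-(2 * (∑ i, w i - M / 2 - 1) ^ 2 / (M - 1))) with hδ
  set W : Fin N × Fin M → ℝ := fun x => w x.2 with hW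
  have hW01 : ∀ x, W x ∈ Set.Icc (0 : ℝ) 1 := fun x => hw x.2
  have hsumM : ∑ i, w i ≤ M := by
    calc ∑ i, w i ≤ ∑ _i : Fin M, (1 : ℝ) := Finset.sum_le_sum fun i _ => (hw i).2
      _ = M := by simp
  have hM4 : 4 ≤ M := by
    have : (4 : ℝ) ≤ M := by linarith
    exact_mod_cast this
  have hWsum : ∀ k, ∑ x ∈ itemCoins M k, W x = ∑ i, w i := fun k => sum_itemCoins k _
  have hupp' : ∀ k, (h k : ℝ) ≤ M / 2 + 1 := by
    intro k
    have : (2 * h k : ℝ) ≤ M + 2 := by exact_mod_cast hupp k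
    linarith
  have herase : ∀ k, ∀ x ∈ itemCoins M k, coinMean W
      (fun b => if hits ((itemCoins M k).erase x) b < h k then 1 else 0) ≤ δ := by
    intro k x hx
    have hcard : ((itemCoins M k).erase x).card = M - 1 := by
      rw [Finset.card_erase_of_mem hx, card_itemCoins]
    have hne : ((itemCoins M k).erase x).Nonempty := by
      rw [← Finset.card_pos, hcard]
      omega
    -- Without one toss the mean is at least `∑ w - 1`, and fewer than `h k` hits means at most `M /
    -- 2`. The gap is `r`, over `M - 1` tosses.
    have hmain := coinMean_hits_lt_le hW01 hne (h := h k) (r := ∑ i, w i - M / 2 - 1)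
      (by linarith) (by
        have h1 := Finset.sum_erase_add (itemCoins M k) W hx
        rw [hWsum] at h1
        linarith [(hW01 x).2, hupp' k])
    rwa [hcard, Nat.cast_sub (by omega), Nat.cast_one] at hmain
  have hvote : ∀ k, (1 - 2 * δ) * ∑ i, (2 * w i - 1) ^ 2 ≤
      ∑ i, (2 * w i - 1) * coinMean W (fun b => relVote h k b * coinSign (b (k, i))) := by
    intro k
    -- At least two votes are needed because `M ≥ 4`. The margin `M / 2 + 2 ≤ ∑ w` is exactly what
    -- yields `m + 3 ≤ ∑ w`.
    obtain ⟨m, hm⟩ : ∃ m, h k = m + 2 := ⟨h k - 2, by have := hlow k; omega⟩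
    have hmcast : (h k : ℝ) = m + 2 := by exact_mod_cast hm
    have hkey := sum_bias_mul_coinMean_le hW01 (S := itemCoins M k) (k := m) (δ := δ)
      (by rw [hWsum]; linarith [hupp' k])
      (by
        rw [sum_itemCoins]
        simp only [hW, Finset.sum_sub_distrib, ← Finset.mul_sum]
        simp
        linarith)
      (fun x hx => by rw [← hm]; exact herase k x hx)
    rw [sum_itemCoins, sum_itemCoins, ← hm] at hkey
    have hsplit : ∑ i, (2 * w i - 1) * coinMean W (fun b => relVote h k b * coinSign (b (k, i))) =
        ∑ i, (2 * w i - 1) ^ 2 - 2 * ∑ i, (2 * w i - 1) * coinMean W (fun b =>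
          (if hits (itemCoins M k) b < h k then 1 else 0) * coinSign (b (k, i))) := by
      rw [Finset.mul_sum, ← Finset.sum_sub_distrib]
      refine Finset.sum_congr rfl fun i _ => ?_
      rw [coinMean_relVote_mul_coinSign]
      ring
    rw [hsplit]
    linarith
  -- The term `k = j` is not a product of independent factors, but its agreement is the constant
  -- `M`, which dominates `∑ (2 * w i - 1) ^ 2`.
  have hself : (1 - 2 * δ) * ∑ i, (2 * w i - 1) ^ 2 ≤
      coinMean W (fun b => relVote h j b * agreement j j b) := by
    have hvotes : ∀ b : Fin N × Fin M → Bool, relVote h j b * agreement j j b =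
        M * (1 - 2 * if hits (itemCoins M j) b < h j then 1 else 0) := by
      intro b
      rw [agreement_self, relVote]
      split_ifs <;> ring
    have herr : coinMean W (fun b => if hits (itemCoins M j) b < h j then 1 else 0) ≤ δ := by
      have hx : (j, (⟨0, by omega⟩ : Fin M)) ∈ itemCoins M j := mem_itemCoins.2 rfl
      refine le_trans (coinMean_mono hW01 fun b => ?_) (herase j _ hx)
      have hle : hits ((itemCoins M j).erase (j, ⟨0, by omega⟩)) b ≤ hits (itemCoins M j) b :=
        Finset.sum_le_sum_of_subset (Finset.erase_subset _ _)
      split_ifs <;> first | omega | norm_num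
    have hsq : ∑ i, (2 * w i - 1) ^ 2 ≤ (M : ℝ) := by
      calc ∑ i, (2 * w i - 1) ^ 2 ≤ ∑ _i : Fin M, (1 : ℝ) := Finset.sum_le_sum fun i _ => by
            nlinarith [(hw i).1, (hw i).2]
        _ = M := by simp
    simp only [hvotes]
    rw [coinMean_const_mul, coinMean_sub, coinMean_const, coinMean_const_mul]
    nlinarith [mul_le_mul_of_nonneg_left hsq (sub_nonneg.2 hη),
      mul_le_mul_of_nonneg_left herr (Nat.cast_nonneg (α := ℝ) M)]
  have hterm : ∀ k, (1 - 2 * δ) * ∑ i, (2 * w i - 1) ^ 2 ≤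
      coinMean W (fun b => relVote h k b * agreement j k b) := by
    intro k
    by_cases hk : k = j
    · rw [hk]; exact hself
    · rw [coinMean_relVote_mul_agreement W h hk]
      exact hvote k
  unfold relScore
  rw [coinMean_sum]
  calc _ = ∑ _k : Fin N, (1 - 2 * δ) * ∑ i, (2 * w i - 1) ^ 2 := by simp
    _ ≤ _ := Finset.sum_le_sum fun k _ => hterm k

end Score

/-! ### From label matrices to coin tosses. -/

section Labels

variable {M N : ℕ}

/-- The label matrix when the toss `b (k, i)` says whether worker `i` is right on item `k`. -/
def labelMatrix (y : Fin N → SignType) (b : Fin N × Fin M → Bool) : Fin M → Fin N → SignType :=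
  fun i k => if b (k, i) then y k else -y k

/-- The number of correct labels that majority voting needs on each item. -/
def votesNeeded (M : ℕ) (τ : SignType) (y : Fin N → SignType) (k : Fin N) : ℕ :=
  if y k = τ then (M + 1) / 2 else M / 2 + 1

theorem labelMatrix_cast (y : Fin N → SignType) (b : Fin N × Fin M → Bool) (i : Fin M)
    (k : Fin N) : (labelMatrix y b i k : ℝ) = y k * coinSign (b (k, i)) := by
  unfold labelMatrix coinSign
  split_ifs <;> simp

theorem sum_coinSign (k : Fin N) (b : Fin N × Fin M → Bool) :
    ∑ i, coinSign (b (k, i)) = 2 * hits (itemCoins M k) b - M := by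
  have h : ∀ i, coinSign (b (k, i)) = 2 * (if b (k, i) then 1 else 0) - 1 := by
    intro i
    unfold coinSign
    split_ifs <;> norm_num
  have hh : (hits (itemCoins M k) b : ℝ) = ∑ i, if b (k, i) then (1 : ℝ) else 0 := by
    rw [hits, Nat.cast_sum, sum_itemCoins]
    simp
  rw [hh]
  simp only [h, Finset.sum_sub_distrib, ← Finset.mul_sum]
  simp

theorem signType_eq_or {s : SignType} (hs : s ≠ 0) : s = 1 ∨ s = -1 := by
  revert hs
  cases s <;> decide

theorem signLabel_of_pos (τ : SignType) {x : ℝ} (hx : 0 < x) : signLabel τ x = 1 := by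
  simp [signLabel, hx.ne', sign_pos hx]

theorem signLabel_of_neg (τ : SignType) {x : ℝ} (hx : x < 0) : signLabel τ x = -1 := by
  simp [signLabel, hx.ne, sign_neg hx]

/-- A tie is possible only for even `M` and is resolved as `τ`: half of the votes then suffice if
the true label is `τ`, while otherwise a strict majority is needed. -/
theorem majorityVote_labelMatrix {τ : SignType} (hτ : τ ≠ 0) {y : Fin N → SignType}
    (hy : ∀ k, y k ≠ 0) (b : Fin N × Fin M → Bool) (k : Fin N) :
    majorityVote τ (labelMatrix y b) k =
      if hits (itemCoins M k) b < votesNeeded M τ y k then -y k else y k := by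
  have hsum : ∑ i, (1 : ℝ) * (labelMatrix y b i k : ℝ) =
      y k * (2 * hits (itemCoins M k) b - M) := by
    simp only [one_mul, labelMatrix_cast, ← Finset.mul_sum, sum_coinSign]
  simp only [majorityVote, weightedVote, hsum]
  have hlow : M ≤ 2 * votesNeeded M τ y k := by unfold votesNeeded; split_ifs <;> omega
  have hupp : 2 * votesNeeded M τ y k ≤ M + 2 := by unfold votesNeeded; split_ifs <;> omega
  have htie : 2 * votesNeeded M τ y k = M ↔ y k = τ ∧ Even M := by
    rw [Nat.even_iff]
    unfold votesNeeded
    split_ifs with h <;> simp only [h, true_and, false_and, iff_false] <;> omega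
  set T := hits (itemCoins M k) b
  rcases lt_trichotomy (2 * T) M with h | h | h
  · have h' : (2 * T : ℝ) - M < 0 := by
      have : (2 * T : ℝ) < M := by exact_mod_cast h
      linarith
    rw [if_pos (by omega)]
    rcases signType_eq_or (hy k) with e | e
    · rw [e, signLabel_of_neg τ (by simpa using h')]
    · rw [e, signLabel_of_pos τ (by simpa using h'), neg_neg]
  · have h' : (2 * T : ℝ) - M = 0 := by
      have : (2 * T : ℝ) = M := by exact_mod_cast h
      linarith
    rw [h', mul_zero, signLabel, if_pos rfl]
    by_cases e : y k = τ
    · have := htie.2 ⟨e, ⟨T, by omega⟩⟩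
      rw [if_neg (by omega), e]
    · have : 2 * votesNeeded M τ y k ≠ M := fun h2 => e (htie.1 h2).1
      rw [if_pos (by omega)]
      rcases signType_eq_or (hy k) with e1 | e1 <;> rcases signType_eq_or hτ with e2 | e2 <;>
        simp_all
  · have h' : 0 < (2 * T : ℝ) - M := by
      have : (M : ℝ) < 2 * T := by exact_mod_cast h
      linarith
    have hT : ¬ T < votesNeeded M τ y k := by
      unfold votesNeeded
      split_ifs <;> omega
    rw [if_neg hT]
    rcases signType_eq_or (hy k) with e | e
    · rw [e, signLabel_of_pos τ (by simpa using h')]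
    · rw [e, signLabel_of_neg τ (by simpa using h')]

theorem estAccuracy_labelMatrix (hN : N ≠ 0) {τ : SignType} (hτ : τ ≠ 0) {y : Fin N → SignType}
    (hy : ∀ k, y k ≠ 0) (b : Fin N × Fin M → Bool) (i : Fin M) :
    2 * estAccuracy (majorityVote τ (labelMatrix y b)) (labelMatrix y b) i - 1 =
      1 / (N : ℝ) * ∑ k, relVote (votesNeeded M τ y) k b * coinSign (b (k, i)) := by
  have hN' : (N : ℝ) ≠ 0 := Nat.cast_ne_zero.2 hN
  have hz : ∀ k, labelMatrix y b i k ≠ 0 := by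
    intro k
    unfold labelMatrix
    rcases signType_eq_or (hy k) with e | e <;> rw [e] <;> split_ifs <;> decide
  -- The true label cancels: a worker agrees with the majority when both are right or both are
  -- wrong.
  have hterm : ∀ k, (if labelMatrix y b i k = majorityVote τ (labelMatrix y b) k then (1 : ℝ)
      else 0) = 1 / 2 * (1 + relVote (votesNeeded M τ y) k b * coinSign (b (k, i))) := by
    intro k
    rw [majorityVote_labelMatrix hτ hy, relVote, coinSign, labelMatrix]
    have h1 : y k ≠ -y k := by
      rcases signType_eq_or (hy k) with e | e <;> rw [e] <;> decide
    have h2 : -y k ≠ y k := h1.symm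
    split_ifs <;> simp_all
    all_goals norm_num
  simp only [estAccuracy, hz, ne_eq, not_false_eq_true, true_and, Finset.filter_true,
    Finset.card_univ, Fintype.card_fin]
  rw [Finset.card_filter, Nat.cast_sum]
  simp only [Nat.cast_ite, Nat.cast_one, Nat.cast_zero, hterm, ← Finset.mul_sum,
    Finset.sum_add_distrib]
  simp
  field_simp
  ring

theorem relScore_nonpos_of_oneStepWMV_ne {τ : SignType} (hτ : τ ≠ 0) {y : Fin N → SignType}
    (hy : ∀ k, y k ≠ 0) (b : Fin N × Fin M → Bool) (j : Fin N)
    (h : oneStepWMV τ (labelMatrix y b) j ≠ y j) : relScore (votesNeeded M τ y) j b ≤ 0 := by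
  by_contra! hpos
  apply h
  have hN : N ≠ 0 := fun h0 => by subst h0; exact j.elim0
  have hN' : (0 : ℝ) < N := Nat.cast_pos.2 (Nat.pos_of_ne_zero hN)
  have hsum : ∑ i, (2 * estAccuracy (majorityVote τ (labelMatrix y b)) (labelMatrix y b) i - 1) *
      (labelMatrix y b i j : ℝ) = y j * (1 / (N : ℝ) * relScore (votesNeeded M τ y) j b) := by
    simp only [estAccuracy_labelMatrix hN hτ hy, labelMatrix_cast, relScore, agreement,
      Finset.mul_sum, Finset.sum_mul]
    rw [Finset.sum_comm]
    exact Finset.sum_congr rfl fun k _ => Finset.sum_congr rfl fun i _ => by ring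
  have hp : 0 < 1 / (N : ℝ) * relScore (votesNeeded M τ y) j b := by positivity
  simp only [oneStepWMV, weightedVote, hsum]
  rcases signType_eq_or (hy j) with e | e
  · rw [e, signLabel_of_pos]
    simpa using hp
  · rw [e, signLabel_of_neg]
    simpa using hp

theorem labelMatrix_injective {y : Fin N → SignType} (hy : ∀ k, y k ≠ 0) :
    Function.Injective (labelMatrix (M := M) y) := by
  intro b b' h
  funext x
  have hx := congrFun (congrFun h x.2) x.1
  have h1 : y x.1 ≠ -y x.1 := by
    rcases signType_eq_or (hy x.1) with e | e <;> rw [e] <;> decide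
  simp only [labelMatrix] at hx
  cases hb : b (x.1, x.2) <;> cases hb' : b' (x.1, x.2) <;> simp_all

theorem entryProb_labelMatrix (w : Fin M → ℝ) {y : Fin N → SignType} (hy : ∀ k, y k ≠ 0)
    (b : Fin N × Fin M → Bool) (i : Fin M) (k : Fin N) :
    entryProb 1 (w i) (y k) (labelMatrix y b i k) = coinWeight (w i) (b (k, i)) := by
  have h1 : -y k ≠ y k := by
    rcases signType_eq_or (hy k) with e | e <;> rw [e] <;> decide
  have h2 : -y k ≠ 0 := by
    rcases signType_eq_or (hy k) with e | e <;> rw [e] <;> decide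
  unfold entryProb labelMatrix coinWeight
  cases b (k, i) <;> simp [h1, h2, hy k]

/-- Summation over label matrices without missing labels as an expectation over coin tosses. -/
theorem sum_entryProb_eq_coinMean (w : Fin M → ℝ) {y : Fin N → SignType} (hy : ∀ k, y k ≠ 0)
    (f : (Fin M → Fin N → SignType) → ℝ) :
    ∑ z, (∏ i, ∏ k, entryProb 1 (w i) (y k) (z i k)) * f z =
      coinMean (fun x : Fin N × Fin M => w x.2) fun b => f (labelMatrix y b) := by
  symm
  refine Finset.sum_of_injOn (labelMatrix y) (labelMatrix_injective hy).injOn (by simp) ?_ ?_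
  · intro z _ hz
    -- A matrix not produced by any toss has a missing entry, of probability `1 - q = 0`.
    obtain ⟨i, k, hik⟩ : ∃ i k, z i k = 0 := by
      by_contra! hne
      refine hz ⟨fun x => decide (z x.2 x.1 = y x.1), by simp, ?_⟩
      funext i k
      simp only [labelMatrix, decide_eq_true_eq]
      rcases signType_eq_or (hy k) with e | e <;> rcases signType_eq_or (hne i k) with e' | e' <;>
        rw [e, e'] <;> decide
    rw [Finset.prod_eq_zero (Finset.mem_univ i), zero_mul]
    exact Finset.prod_eq_zero (Finset.mem_univ k) (by simp [entryProb, hik])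
  · intro b _
    simp only [entryProb_labelMatrix w hy]
    rw [Fintype.prod_prod_type_right]

end Labels

/-! ### The accuracy threshold and the error probability of one item. -/

section ErrorRate

variable {M N : ℕ}

theorem sum_sq_bias_eq_dispersion_sq (w : Fin M → ℝ) (hM : M ≠ 0) :
    ∑ i, (2 * w i - 1) ^ 2 = 4 * M * dispersion w ^ 2 := by
  have hM' : (M : ℝ) ≠ 0 := Nat.cast_ne_zero.2 hM
  rw [dispersion, Real.sq_sqrt (by positivity)]
  have : ∑ i, (2 * w i - 1) ^ 2 = 4 * ∑ i, (w i - 1 / 2) ^ 2 := by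
    rw [Finset.mul_sum]
    exact Finset.sum_congr rfl fun i _ => by ring
  rw [this, mul_assoc 4, ← mul_assoc (M : ℝ), mul_one_div_cancel hM', one_mul]

/-- The accuracy threshold makes `η` at most `1` and forces more than three workers. -/
theorem accuracy_margin {w : Fin M → ℝ} (hw01 : ∀ i, w i ∈ Set.Icc (0 : ℝ) 1)
    (hw : avgAccuracy w ≥
      1 / 2 + 1 / (M : ℝ) + √(((M : ℝ) - 1) * Real.log 2 / (2 * (M : ℝ) ^ 2))) :
    M ≠ 0 ∧ (M : ℝ) / 2 + 2 ≤ ∑ i, w i ∧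
      eta w = 2 * Real.exp (-(2 * (∑ i, w i - M / 2 - 1) ^ 2 / (M - 1))) ∧ eta w ≤ 1 := by
  have hM0 : M ≠ 0 := by
    -- For `M = 0` divisions by zero give 0, so the threshold would say that 0 is at least `1 / 2`.
    rintro rfl
    simp [avgAccuracy] at hw
    linarith [Real.sqrt_nonneg (-Real.log 2 / 0)]
  have hM1 : (1 : ℝ) ≤ M := by exact_mod_cast Nat.one_le_iff_ne_zero.2 hM0
  have hMpos : (0 : ℝ) < M := by linarith
  set W := ∑ i, w i with hW
  have hWM : W ≤ M := by
    calc ∑ i, w i ≤ ∑ _i : Fin M, (1 : ℝ) := Finset.sum_le_sum fun i _ => (hw01 i).2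
      _ = M := by simp
  have hlog : (0.69 : ℝ) < Real.log 2 := by linarith [Real.log_two_gt_d9]
  have hr : (W - M / 2 - 1) = M * (avgAccuracy w - 1 / 2 - 1 / (M : ℝ)) := by
    rw [avgAccuracy, ← hW]
    field_simp
  have hsqrt := Real.sqrt_nonneg (((M : ℝ) - 1) * Real.log 2 / (2 * (M : ℝ) ^ 2))
  have hr0 : 0 ≤ W - M / 2 - 1 := by
    rw [hr]
    exact mul_nonneg hMpos.le (by linarith)
  have hr2 : ((M : ℝ) - 1) * Real.log 2 ≤ 2 * (W - M / 2 - 1) ^ 2 := by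
    have h1 := Real.sqrt_le_left (x := ((M : ℝ) - 1) * Real.log 2 / (2 * (M : ℝ) ^ 2))
      (y := avgAccuracy w - 1 / 2 - 1 / (M : ℝ)) (by linarith)
    have h2 := h1.1 (by linarith)
    rw [div_le_iff₀ (by positivity)] at h2
    rw [hr]
    nlinarith
  have hM2 : (1 : ℝ) < M := by linarith
  have heta : eta w = 2 * Real.exp (-(2 * (W - M / 2 - 1) ^ 2 / (M - 1))) := by
    rw [eta, hr]
    ring_nf
  refine ⟨hM0, ?_, heta, ?_⟩
  -- Let `r = W - M / 2 - 1`. Then `W ≤ M` gives `M - 1 ≥ 2 * r + 1`, so `2 * r ^ 2 ≥ (2 * r + 1) *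
  -- log 2`. This fails on `0 ≤ r ≤ 1` because `3 * log 2 > 2`; hence `r > 1`.
  · nlinarith
  · have h1 : Real.log 2 ≤ 2 * (W - M / 2 - 1) ^ 2 / (M - 1) := by
      rw [le_div_iff₀ (by linarith)]
      linarith
    have h2 : Real.exp (-(2 * (W - M / 2 - 1) ^ 2 / (M - 1))) ≤ Real.exp (-Real.log 2) :=
      Real.exp_le_exp.2 (by linarith)
    rw [Real.exp_neg (Real.log 2), Real.exp_log (by norm_num)] at h2
    rw [heta]
    linarith

theorem coinMean_relScore_nonpos_le {w : Fin M → ℝ} (hw01 : ∀ i, w i ∈ Set.Icc (0 : ℝ) 1)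
    (hw : avgAccuracy w ≥
      1 / 2 + 1 / (M : ℝ) + √(((M : ℝ) - 1) * Real.log 2 / (2 * (M : ℝ) ^ 2)))
    {h : Fin N → ℕ} (hlow : ∀ k, M ≤ 2 * h k) (hupp : ∀ k, 2 * h k ≤ M + 2) (j : Fin N) :
    coinMean (fun x : Fin N × Fin M => w x.2) (fun b => if relScore h j b ≤ 0 then 1 else 0) ≤
      Real.exp (-(8 * (M : ℝ) * (N : ℝ) ^ 2 * dispersion w ^ 4 * (1 - eta w) ^ 2 /
        ((M : ℝ) ^ 2 * (N : ℝ) + ((M : ℝ) + (N : ℝ)) ^ 2))) := by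
  obtain ⟨hM0, hsum, heta, heta1⟩ := accuracy_margin hw01 hw
  have hMpos : (0 : ℝ) < M := Nat.cast_pos.2 (Nat.pos_of_ne_zero hM0)
  have hmean := le_coinMean_relScore hw01 hsum hlow hupp (heta ▸ heta1) j
  rw [← heta, sum_sq_bias_eq_dispersion_sq w hM0] at hmean
  have hD : 0 < (M : ℝ) ^ 2 * N + ((M : ℝ) + N) ^ 2 := by positivity
  have heta0 : 0 ≤ 1 - eta w := sub_nonneg.2 heta1
  generalize 1 - eta w = e at hmean heta0 ⊢
  generalize dispersion w = d at hmean ⊢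
  have hmain := coinMean_le_exp_of_bounded_differences
    (w := fun x : Fin N × Fin M => w x.2) (fun x => hw01 x.2)
    (fun x => if x.1 = j then 2 * ((M : ℝ) + N) else 2 * M) (relScore h j)
    (abs_relScore_update_sub_le h j) (r := N * (e * (4 * M * d ^ 2))) (x := 0) (by positivity)
    (sum_sq_difference_le j) (by positivity) (by linarith)
  have hexp : 2 * (N * (e * (4 * M * d ^ 2))) ^ 2 / (4 * M * ((M : ℝ) ^ 2 * N + (M + N) ^ 2)) =
      8 * M * N ^ 2 * d ^ 4 * e ^ 2 / ((M : ℝ) ^ 2 * N + (M + N) ^ 2) := by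
    rw [div_eq_div_iff (by positivity) hD.ne']
    ring
  rwa [hexp] at hmain

theorem sum_labels_le_one {Ω : Type*} [MeasurableSpace Ω] (P : Measure Ω)
    [IsProbabilityMeasure P] {Y : Ω → Fin N → SignType} {Z : Ω → Fin M → Fin N → SignType}
    (hmeas : ∀ y z, MeasurableSet {ω | Y ω = y ∧ Z ω = z}) :
    ∑ y, P.real {ω | Y ω = y} ≤ 1 := by
  have hY : ∀ y, MeasurableSet {ω | Y ω = y} := by
    intro y
    have : {ω | Y ω = y} = ⋃ z, {ω | Y ω = y ∧ Z ω = z} := by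
      ext ω
      simp
    rw [this]
    exact MeasurableSet.iUnion fun z => hmeas y z
  refine (sum_measureReal_le_measureReal_univ (fun y _ => hY y) ?_).trans_eq (by simp)
  intro y _ y' _ hne
  exact Set.disjoint_left.2 fun ω h h' => hne (h.symm.trans h')

theorem measureReal_oneStepWMV_ne_le {Ω : Type*} [MeasurableSpace Ω] (P : Measure Ω)
    [IsProbabilityMeasure P] {w : Fin M → ℝ} {p : ℝ} {Y : Ω → Fin N → SignType}
    {Z : Ω → Fin M → Fin N → SignType} (hmodel : IsOneCoinModel P w (fun _ _ => 1) p Y Z)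
    {τ : SignType} (hτ : τ ≠ 0)
    (hw : avgAccuracy w ≥
      1 / 2 + 1 / (M : ℝ) + √(((M : ℝ) - 1) * Real.log 2 / (2 * (M : ℝ) ^ 2))) (j : Fin N) :
    P.real {ω | oneStepWMV τ (Z ω) j ≠ Y ω j} ≤
      Real.exp (-(8 * (M : ℝ) * (N : ℝ) ^ 2 * dispersion w ^ 4 * (1 - eta w) ^ 2 /
        ((M : ℝ) ^ 2 * (N : ℝ) + ((M : ℝ) + (N : ℝ)) ^ 2))) := by
  set B := Real.exp (-(8 * (M : ℝ) * (N : ℝ) ^ 2 * dispersion w ^ 4 * (1 - eta w) ^ 2 /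
        ((M : ℝ) ^ 2 * (N : ℝ) + ((M : ℝ) + (N : ℝ)) ^ 2)))
  have hcond : ∀ y : Fin N → SignType, (∀ k, y k ≠ 0) →
      ∑ z, (∏ i, ∏ k, entryProb 1 (w i) (y k) (z i k)) *
        (if oneStepWMV τ z j ≠ y j then 1 else 0) ≤ B := by
    intro y hy
    rw [sum_entryProb_eq_coinMean w hy (fun z => if oneStepWMV τ z j ≠ y j then 1 else 0)]
    have hle : ∀ b : Fin N × Fin M → Bool, (if oneStepWMV τ (labelMatrix y b) j ≠ y j
        then (1 : ℝ) else 0) ≤ if relScore (votesNeeded M τ y) j b ≤ 0 then 1 else 0 := by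
      intro b
      by_cases hb : oneStepWMV τ (labelMatrix y b) j ≠ y j
      · rw [if_pos hb, if_pos (relScore_nonpos_of_oneStepWMV_ne hτ hy b j hb)]
      · rw [if_neg hb]
        split_ifs <;> norm_num
    have hlow : ∀ k, M ≤ 2 * votesNeeded M τ y k := fun k => by
      unfold votesNeeded
      split_ifs <;> omega
    have hupp : ∀ k, 2 * votesNeeded M τ y k ≤ M + 2 := fun k => by
      unfold votesNeeded
      split_ifs <;> omega
    have hmono := coinMean_mono (w := fun x : Fin N × Fin M => w x.2)
      (fun x => hmodel.accuracy_mem x.2) hle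
    exact hmono.trans (coinMean_relScore_nonpos_le hmodel.accuracy_mem hw hlow hupp j)
  -- The error event is covered by the finitely many atoms of `(Y, Z)` on which the rule errs, so
  -- subadditivity suffices.
  have hcover : {ω | oneStepWMV τ (Z ω) j ≠ Y ω j} ⊆
      ⋃ x ∈ (Finset.univ : Finset ((Fin N → SignType) × (Fin M → Fin N → SignType))).filter
        (fun x => oneStepWMV τ x.2 j ≠ x.1 j), {ω | Y ω = x.1 ∧ Z ω = x.2} := by
    intro ω hω
    simp only [Set.mem_iUnion]
    exact ⟨(Y ω, Z ω), by simpa using hω, rfl, rfl⟩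
  calc P.real {ω | oneStepWMV τ (Z ω) j ≠ Y ω j}
      ≤ ∑ x ∈ (Finset.univ : Finset ((Fin N → SignType) × (Fin M → Fin N → SignType))).filter
          (fun x => oneStepWMV τ x.2 j ≠ x.1 j), P.real {ω | Y ω = x.1 ∧ Z ω = x.2} :=
        (measureReal_mono hcover (measure_ne_top P _)).trans (measureReal_biUnion_finset_le _ _)
    _ = ∑ y, P.real {ω | Y ω = y} * ∑ z, (∏ i, ∏ k, entryProb 1 (w i) (y k) (z i k)) *
          (if oneStepWMV τ z j ≠ y j then 1 else 0) := by
        rw [Finset.sum_filter, Fintype.sum_prod_type]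
        refine Finset.sum_congr rfl fun y _ => ?_
        rw [Finset.mul_sum]
        refine Finset.sum_congr rfl fun z _ => ?_
        rw [hmodel.law]
        split_ifs <;> simp
    _ ≤ ∑ y, P.real {ω | Y ω = y} * B := by
        refine Finset.sum_le_sum fun y _ => ?_
        by_cases hy : ∀ k, y k ≠ 0
        · exact mul_le_mul_of_nonneg_left (hcond y hy) measureReal_nonneg
        -- A vector with a zero coordinate is almost surely not the vector of true labels.
        · have h0 : P {ω | Y ω = y} = 0 := by
            refine measure_mono_null (fun ω hω => ?_) (ae_iff.1 hmodel.true_ne_zero)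
            have hω' : Y ω = y := hω
            simpa [hω'] using hy
          simp [measureReal_def, h0]
    _ ≤ 1 * B := by
        rw [← Finset.sum_mul]
        exact mul_le_mul_of_nonneg_right (sum_labels_le_one P hmodel.measurable_labels)
          (Real.exp_pos _).le
    _ = B := one_mul B

end ErrorRate

end Crowd

end

theorem theorem5 {Ω : Type*} [MeasurableSpace Ω] (P : MeasureTheory.Measure Ω)
    [MeasureTheory.IsProbabilityMeasure P] (M N : ℕ) (w : Fin M → ℝ) (p : ℝ)
    (Y : Ω → Fin N → SignType) (Z : Ω → Fin M → Fin N → SignType)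
    (hmodel : Crowd.IsOneCoinModel P w (fun _ _ => 1) p Y Z)
    (τ : SignType) (hτ : τ ≠ 0)
    (hw : Crowd.avgAccuracy w ≥
      1 / 2 + 1 / (M : ℝ) + √(((M : ℝ) - 1) * Real.log 2 / (2 * (M : ℝ) ^ 2))) :
    Crowd.meanErrorRate P Y (fun ω => Crowd.oneStepWMV τ (Z ω)) ≤
      Real.exp (-(8 * (M : ℝ) * (N : ℝ) ^ 2 * Crowd.dispersion w ^ 4 * (1 - Crowd.eta w) ^ 2 /
        ((M : ℝ) ^ 2 * (N : ℝ) + ((M : ℝ) + (N : ℝ)) ^ 2))) := by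
  unfold Crowd.meanErrorRate
  rcases Nat.eq_zero_or_pos N with rfl | hN
  · simp
  · have hN' : (0 : ℝ) < N := Nat.cast_pos.2 hN
    rw [one_div, inv_mul_le_iff₀ hN']
    refine (Finset.sum_le_sum fun j _ =>
      Crowd.measureReal_oneStepWMV_ne_le P hmodel hτ hw j).trans_eq ?_
    simp
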